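/- **Conventions.** A *generalised hexagon* is a nonempty point-line geometry $\Gamma$ containing no ordinary $2$-, $3$-, $4$- or $5$-gon and in which any two elements (points or lines) lie in an ordinary hexagon (an *apartment*). It is *thick* if every element is incident with at least three elements. A *root* is a path $\alpha=(x_0,\dots,x_6)$ of seven consecutive elements of an apartment; its *root group* $U_\alpha$ consists of the collineations (type-preserving automorphisms) of $\Gamma$ fixing every element incident with one of $x_1,\dots,x_5$. A *Moufang hexagon* is a thick generalised hexagon in which, for every root $\alpha$, the group $U_\alpha$ is transitive on the elements incident with $x_0$ and different from $x_1$. A *hexagonal system* $(\mathbb J,\mathbb F,\#)$ consists of a commutative field $\mathbb F$, an $\mathbb F$-vector space $\mathbb J$, a map $\#:\mathbb J\to\mathbb J$, a map $\mathsf N:\mathbb J\to\mathbb F$, a symmetric bilinear form $\mathsf T:\mathbb J\times\mathbb J\to\mathbb F$, a symmetric bilinear map $\times:\mathbb J\times\mathbb J\to\mathbb J$ and an element $1\in\mathbb J\setminus\{0\}$ such that for all $t\in\mathbb F$ and $a,b,c\in\mathbb J$: $(ta)^\#=t^2a^\#$; $\mathsf N(ta)=t^3\mathsf N(a)$; $\mathsf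 T(a\times b,c)=\mathsf T(a,b\times c)$; $(a+b)^\#=a^\#+a\times b+b^\#$; $\mathsf N(a+b)=\mathsf N(a)+\mathsf T(a^\#,b)+\mathsf T(a,b^\#)+\mathsf N(b)$; $\mathsf T(a,a^\#)=3\mathsf N(a)$; $a^{\#\#}=\mathsf N(a)a$; $a^\#\times(a\times b)=\mathsf N(a)b+\mathsf T(a^\#,b)a$; $a^\#\times b^\#+(a\times b)^\#=\mathsf T(a^\#,b)b+\mathsf T(a,b^\#)a$; $1^\#=1$; $a=\mathsf T(a,1)1-1\times a$; and $\mathsf N(a)=0$ if and only if $a=0$. A Moufang hexagon $\Gamma$ is *associated* to $(\mathbb J,\mathbb F,\#)$ if it has an apartment, with elements labelled cyclically by the integers modulo $12$, the element $7$ being a point and $6$ a line, and isomorphisms $x_i$ from the additive group of $\mathbb J$ ($i$ odd) or of $\mathbb F$ ($i$ even) onto the root group $U_i$ of the root $(i,i+1,\dots,i+6)$, $1\le i\le 6$, such that, with $[g,h]=g^{-1}h^{-1}gh$, $$[x_1(a),x_3(b)]=x_2(\mathsf T(a,b)),\qquad [x_3(a),x_5(b)]=x_4(\mathsf T(a,b)),\qquad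 [x_2(t),x_6(u)]=x_4(tu),$$ $$[x_1(a),x_5(b)]=x_2(-\mathsf T(a^\#,b))\,x_3(a\times b)\,x_4(\mathsf T(a,b^\#)),$$ $$[x_1(a),x_6(t)]=x_2(-t\mathsf N(a))\,x_3(ta^\#)\,x_4(t^2\mathsf N(a))\,x_5(-ta)$$ for all $a,b\in\mathbb J$ and $t,u\in\mathbb F$, and all other commutators of elements of $U_i$ and $U_j$ ($1\le i<j\le 6$) are trivial. (Thus the points on a line are indexed by $\{\infty\}\cup\mathbb F$ and the lines through a point by $\{\infty\}\cup\mathbb J$.) The hexagon $\Gamma$ is in *class* $(\mathrm{H4})$, or *mixed*, if it is associated to a hexagonal system $(\mathbb E,\mathbb F,\#)$ where $\operatorname{char}\mathbb F=3$, $\mathbb E$ is a field with $\mathbb E^3\subseteq\mathbb F\subseteq\mathbb E$ (possibly $\mathbb E=\mathbb F$), and $a^\#=a^2$, $\mathsf N(a)=a^3$, $\mathsf T(a,b)=3ab=0$, $a\times b=2ab$. **Lemma.** Let $\Gamma$ be a Moufang hexagon associated to a hexagonal system $(\mathbb J,\mathbb F,\#)$. There exists a collineation of $\Gamma$ whose set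 of fixed elements is precisely a ball of radius $3$ in the incidence graph centred at a line if and only if $\Gamma$ is in class $(\mathrm{H4})$. In this case all such collineations are conjugate, in the full collineation group of $\Gamma$, to the short root elation $x_3(1)$. -/

import Mathlib

universe u v w z

/-! ### Hexagonal systems -/

/-- A hexagonal system `(J, F, #)` (an anisotropic cubic norm structure) in the sense of
Tits and Weiss, together with its norm `N`, trace form `T`, product `×` and unit `1`
(all of which are determined by `#`). -/
structure HexagonalSystem (F : Type u) (J : Type v) [Field F] [AddCommGroup J] [Module F J] where
  /-- the adjoint `#` -/
  sharp : J → J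
  /-- the norm `N` -/
  N : J → F
  /-- the trace form `T(·,·)` -/
  T : J →ₗ[F] J →ₗ[F] F
  /-- the bilinear product `×` -/
  cross : J →ₗ[F] J →ₗ[F] J
  /-- the unit `1` -/
  one : J
  one_ne_zero : one ≠ 0
  T_symm : ∀ a b, T a b = T b a
  cross_symm : ∀ a b, cross a b = cross b a
  sharp_smul : ∀ (t : F) (a : J), sharp (t • a) = t ^ 2 • sharp a
  N_smul : ∀ (t : F) (a : J), N (t • a) = t ^ 3 * N a
  T_cross : ∀ a b c, T (cross a b) c = T a (cross b c)
  sharp_add : ∀ a b, sharp (a + b) = sharp a + cross a b + sharp b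
  N_add : ∀ a b, N (a + b) = N a + T (sharp a) b + T a (sharp b) + N b
  T_sharp : ∀ a, T a (sharp a) = 3 * N a
  sharp_sharp : ∀ a, sharp (sharp a) = N a • a
  sharp_cross_cross : ∀ a b, cross (sharp a) (cross a b) = N a • b + T (sharp a) b • a
  sharp_cross_sharp : ∀ a b,
    cross (sharp a) (sharp b) + sharp (cross a b) = T (sharp a) b • b + T a (sharp b) • a
  sharp_one : sharp one = one
  eq_T_sub_cross : ∀ a, a = T a one • one - cross one a
  N_eq_zero_iff : ∀ a, N a = 0 ↔ a = 0

/-- The hexagonal system `(E, F, #)` of a field extension `E / F` with `char F = 3` and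
`E³ ⊆ F ⊆ E`: here `a^# = a²`, `N(a) = a³`, `T(a, b) = 3ab = 0`, `a × b = 2ab`. The case
`E = F` is allowed. -/
noncomputable def mixedSystem (F : Type u) (E : Type v) [Field F] [Field E] [Algebra F E]
    [CharP F 3] (h : ∀ a : E, ∃ t : F, algebraMap F E t = a ^ 3) : HexagonalSystem F E :=
  have h3 : (3 : F) = 0 := CharP.cast_eq_zero F 3
  have h3' : (3 : E) = 0 := by
    rw [← map_ofNat (algebraMap F E) 3, h3, map_zero]
  have inj : Function.Injective (algebraMap F E) := (algebraMap F E).injective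
  have hc : ∀ a b : E, ((2 : F) • LinearMap.mul F E) a b = 2 * (a * b) := fun a b => by
    rw [LinearMap.smul_apply, LinearMap.smul_apply, LinearMap.mul_apply', Algebra.smul_def,
      map_ofNat]
  { sharp := fun a => a ^ 2
    N := fun a => (h a).choose
    T := 0
    cross := (2 : F) • LinearMap.mul F E
    one := 1
    one_ne_zero := one_ne_zero
    T_symm := fun a b => by simp
    cross_symm := fun a b => by simp [mul_comm]
    sharp_smul := fun t a => by simp only [Algebra.smul_def, map_pow]; ring
    N_smul := fun t a => by
      apply inj
      rw [(h (t • a)).choose_spec, map_mul, (h a).choose_spec, Algebra.smul_def, map_pow]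
      ring
    T_cross := fun a b c => by simp
    sharp_add := fun a b => by
      rw [hc]; ring
    N_add := fun a b => by
      apply inj
      simp only [LinearMap.zero_apply, add_zero]
      rw [(h (a + b)).choose_spec, map_add, (h a).choose_spec, (h b).choose_spec]
      linear_combination (a ^ 2 * b + a * b ^ 2) * h3'
    T_sharp := fun a => by simp [h3]
    sharp_sharp := fun a => by
      rw [Algebra.smul_def, (h a).choose_spec]; ring
    sharp_cross_cross := fun a b => by
      rw [hc, hc, LinearMap.zero_apply, LinearMap.zero_apply, zero_smul, Algebra.smul_def,
        (h a).choose_spec]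
      linear_combination (a ^ 3 * b) * h3'
    sharp_cross_sharp := fun a b => by
      rw [hc, hc]
      simp only [LinearMap.zero_apply, zero_smul]
      linear_combination (2 * a ^ 2 * b ^ 2) * h3'
    sharp_one := one_pow 2
    eq_T_sub_cross := fun a => by
      rw [hc]
      simp only [LinearMap.zero_apply, zero_smul]
      linear_combination a * h3'
    N_eq_zero_iff := fun a => by
      rw [← inj.eq_iff, (h a).choose_spec, map_zero]
      exact pow_eq_zero_iff (by norm_num) }

/-! ### Point-line geometries and generalised hexagons -/

/-- A point-line geometry with point set `P` and line set `L`. -/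
structure PointLineGeometry (P : Type w) (L : Type z) where
  /-- incidence -/
  Inc : P → L → Prop

namespace PointLineGeometry

variable {P : Type w} {L : Type z}

/-- The incidence graph, with vertex set the disjoint union of points and lines. -/
def incGraph (Γ : PointLineGeometry P L) : SimpleGraph (P ⊕ L) where
  Adj x y := (∃ p l, x = Sum.inl p ∧ y = Sum.inr l ∧ Γ.Inc p l) ∨
    (∃ p l, x = Sum.inr l ∧ y = Sum.inl p ∧ Γ.Inc p l)
  symm := ⟨by
    rintro x y (⟨p, l, hx, hy, h⟩ | ⟨p, l, hx, hy, h⟩)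
    · exact Or.inr ⟨p, l, hy, hx, h⟩
    · exact Or.inl ⟨p, l, hy, hx, h⟩⟩
  loopless := ⟨by
    rintro x (⟨p, l, hx, hy, -⟩ | ⟨p, l, hx, hy, -⟩) <;> simp [hx] at hy⟩

/-- A circuit of length `n` in the incidence graph. For `n = 2k` with `k ≥ 2`, this is an ordinary
`k`-gon (with a starting element and a direction). -/
def IsCircuit (Γ : PointLineGeometry P L) (n : ℕ) (c : ZMod n → P ⊕ L) : Prop :=
  Function.Injective c ∧ ∀ i, Γ.incGraph.Adj (c i) (c (i + 1))

/-- An apartment: an ordinary hexagon, its 12 elements labelled cyclically. -/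
def IsApartment (Γ : PointLineGeometry P L) (c : ZMod 12 → P ⊕ L) : Prop :=
  Γ.IsCircuit 12 c

/-- Generalised hexagons: nonempty, without ordinary `2`-, `3`-, `4`-, `5`-gons, and such that any
two elements are contained in an ordinary hexagon. -/
structure IsGeneralizedHexagon (Γ : PointLineGeometry P L) : Prop where
  nonempty : Nonempty (P ⊕ L)
  no_small_polygon : ∀ k : ℕ, 2 ≤ k → k ≤ 5 → ∀ c : ZMod (2 * k) → P ⊕ L, ¬ Γ.IsCircuit (2 * k) c
  exists_apartment : ∀ x y : P ⊕ L,
    ∃ c : ZMod 12 → P ⊕ L, Γ.IsApartment c ∧ x ∈ Set.range c ∧ y ∈ Set.range c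

/-- Thickness: every element is incident with at least three elements. -/
def IsThick (Γ : PointLineGeometry P L) : Prop :=
  ∀ x : P ⊕ L, 3 ≤ (Γ.incGraph.neighborSet x).encard

/-- The full collineation group: pairs of a permutation of the points and a permutation of the
lines that preserve incidence in both directions; multiplication is composition. -/
def collineationGroup (Γ : PointLineGeometry P L) :
    Subgroup (Equiv.Perm P × Equiv.Perm L) where
  carrier := {g | ∀ p l, Γ.Inc (g.1 p) (g.2 l) ↔ Γ.Inc p l}
  one_mem' := fun _ _ => Iff.rfl
  mul_mem' := fun {g h} hg hh p l => (hg (h.1 p) (h.2 l)).trans (hh p l)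
  inv_mem' := fun {g} hg p l => by
    have := hg (g.1⁻¹ p) (g.2⁻¹ l)
    simpa using this.symm

/-- Collineations of `Γ`. -/
abbrev Collineation (Γ : PointLineGeometry P L) : Type (max w z) := Γ.collineationGroup

/-- The image of an element (point or line) under a collineation. -/
def Collineation.act {Γ : PointLineGeometry P L} (θ : Γ.Collineation) : P ⊕ L → P ⊕ L :=
  Sum.map θ.1.1 θ.1.2

/-- The root group `U_α` of the root `α = (c i, c (i+1), …, c (i+6))`: the collineations fixing all
elements incident with one of the interior elements `c (i+1), …, c (i+5)`. -/
def rootGroup (Γ : PointLineGeometry P L) (c : ZMod 12 → P ⊕ L) (i : ZMod 12) :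
    Subgroup Γ.Collineation where
  carrier := {θ | ∀ k : ℕ, 1 ≤ k → k ≤ 5 → ∀ y, Γ.incGraph.Adj (c (i + k)) y → θ.act y = y}
  one_mem' := fun _ _ _ y _ => by cases y <;> rfl
  mul_mem' := fun {g h} hg hh k h1 h5 y hy => by
    have e : (g * h).act y = g.act (h.act y) := by cases y <;> rfl
    rw [e, hh k h1 h5 y hy, hg k h1 h5 y hy]
  inv_mem' := fun {g} hg k h1 h5 y hy => by
    have e : g⁻¹.act (g.act y) = y := by
      cases y <;> simp [Collineation.act]
    have := hg k h1 h5 y hy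
    rwa [this] at e

/-- Moufang hexagons: thick generalised hexagons such that for every root
`α = (x₀, …, x₆)` the root group `U_α` is transitive on the elements incident with `x₀` other
than `x₁` (equivalently, on the apartments containing `α`). -/
structure IsMoufangHexagon (Γ : PointLineGeometry P L) : Prop where
  hexagon : Γ.IsGeneralizedHexagon
  thick : Γ.IsThick
  moufang : ∀ c : ZMod 12 → P ⊕ L, Γ.IsApartment c → ∀ (i : ZMod 12) (y y' : P ⊕ L),
    Γ.incGraph.Adj (c i) y → y ≠ c (i + 1) → Γ.incGraph.Adj (c i) y' → y' ≠ c (i + 1) →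
    ∃ θ ∈ Γ.rootGroup c i, θ.act y = y'

/-- `θ` fixes precisely the elements of a ball of radius 3 in the incidence graph centred at a
line. -/
def FixesExactlyLineBall (Γ : PointLineGeometry P L) (θ : Γ.Collineation) : Prop :=
  ∃ l : L, ∀ x : P ⊕ L, θ.act x = x ↔ Γ.incGraph.edist (Sum.inr l) x ≤ 3

/-- `x` is an isomorphism from the additive group `A` onto the subgroup `U`. -/
def IsLabelling {G : Type*} [Group G] {A : Type*} [AddCommGroup A] (U : Subgroup G)
    (x : A → G) : Prop :=
  Function.Injective x ∧ Set.range x = U ∧ ∀ a b, x (a + b) = x a * x b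

/-- The commutator `[g, h] = g⁻¹h⁻¹gh`. -/
def comm {G : Type*} [Group G] (g h : G) : G := g⁻¹ * h⁻¹ * g * h

/-- `Γ` is associated to the hexagonal system `(J, F, #)`: an apartment with elements labelled by
the integers modulo `12`, and labellings `x₁, …, x₆` by `J` (odd index) and `F` (even index) of the
root groups `U₁, …, U₆`, where `Uᵢ` belongs to the root `(i, i+1, …, i+6)`, such that the
commutator relations of `(J, F, #)` hold. The chamber fixed by `U₁, …, U₆` is `{6, 7}`; the
element `7` is a point and `6` is a line, so `U₁` permutes regularly the lines other
than `6` through the point `7`, and `U₆` the points other than `7` on the line `6`: the points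
on a line are indexed by `{∞} ∪ F`, and the lines through a point by `{∞} ∪ J`. -/
structure AssociatedTo {F : Type u} {J : Type v} [Field F] [AddCommGroup J] [Module F J]
    (Γ : PointLineGeometry P L) (S : HexagonalSystem F J) where
  /-- the apartment `A₀` -/
  apt : ZMod 12 → P ⊕ L
  isApartment : Γ.IsApartment apt
  apt_point : ∃ p, apt 7 = Sum.inl p
  x₁ : J → Γ.Collineation
  x₂ : F → Γ.Collineation
  x₃ : J → Γ.Collineation
  x₄ : F → Γ.Collineation
  x₅ : J → Γ.Collineation
  x₆ : F → Γ.Collineation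
  label₁ : IsLabelling (Γ.rootGroup apt 1) x₁
  label₂ : IsLabelling (Γ.rootGroup apt 2) x₂
  label₃ : IsLabelling (Γ.rootGroup apt 3) x₃
  label₄ : IsLabelling (Γ.rootGroup apt 4) x₄
  label₅ : IsLabelling (Γ.rootGroup apt 5) x₅
  label₆ : IsLabelling (Γ.rootGroup apt 6) x₆
  comm₁₂ : ∀ a t, comm (x₁ a) (x₂ t) = 1
  comm₁₃ : ∀ a b, comm (x₁ a) (x₃ b) = x₂ (S.T a b)
  comm₁₄ : ∀ a t, comm (x₁ a) (x₄ t) = 1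
  comm₁₅ : ∀ a b, comm (x₁ a) (x₅ b) =
    x₂ (-S.T (S.sharp a) b) * x₃ (S.cross a b) * x₄ (S.T a (S.sharp b))
  comm₁₆ : ∀ a t, comm (x₁ a) (x₆ t) =
    x₂ (-(t * S.N a)) * x₃ (t • S.sharp a) * x₄ (t ^ 2 * S.N a) * x₅ (-(t • a))
  comm₂₃ : ∀ t a, comm (x₂ t) (x₃ a) = 1
  comm₂₄ : ∀ t u, comm (x₂ t) (x₄ u) = 1
  comm₂₅ : ∀ t a, comm (x₂ t) (x₅ a) = 1
  comm₂₆ : ∀ t u, comm (x₂ t) (x₆ u) = x₄ (t * u)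
  comm₃₄ : ∀ a t, comm (x₃ a) (x₄ t) = 1
  comm₃₅ : ∀ a b, comm (x₃ a) (x₅ b) = x₄ (S.T a b)
  comm₃₆ : ∀ a t, comm (x₃ a) (x₆ t) = 1
  comm₄₅ : ∀ t a, comm (x₄ t) (x₅ a) = 1
  comm₄₆ : ∀ t u, comm (x₄ t) (x₆ u) = 1
  comm₅₆ : ∀ a t, comm (x₅ a) (x₆ t) = 1

/-- Class (H4), the mixed hexagons: those associated to a hexagonal system `(E, F, #)` with
`char F = 3`, `E³ ⊆ F ⊆ E` and `a^# = a²`. -/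
def InClassH4 (Γ : PointLineGeometry P L) : Prop :=
  ∃ (F : Type u) (E : Type v) (_ : Field F) (_ : Field E) (_ : Algebra F E) (_ : CharP F 3)
    (h : ∀ a : E, ∃ t : F, algebraMap F E t = a ^ 3), Nonempty (Γ.AssociatedTo (mixedSystem F E h))

end PointLineGeometry

namespace PointLineGeometry

variable {P : Type w} {L : Type z} {Γ : PointLineGeometry P L}

/-! ### Collineations acting on the incidence graph -/

namespace Collineation

theorem act_mul (g h : Γ.Collineation) (y : P ⊕ L) : (g * h).act y = g.act (h.act y) := by
  cases y <;> rfl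

theorem act_one (y : P ⊕ L) : (1 : Γ.Collineation).act y = y := by
  cases y <;> rfl

theorem act_inv_act (g : Γ.Collineation) (y : P ⊕ L) : g⁻¹.act (g.act y) = y := by
  rw [← act_mul, inv_mul_cancel, act_one]

theorem act_act_inv (g : Γ.Collineation) (y : P ⊕ L) : g.act (g⁻¹.act y) = y := by
  rw [← act_mul, mul_inv_cancel, act_one]

theorem act_injective (g : Γ.Collineation) : Function.Injective g.act :=
  Function.LeftInverse.injective g.act_inv_act

theorem act_inv_eq {g : Γ.Collineation} {x y : P ⊕ L} (h : g.act x = y) : g⁻¹.act y = x := by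
  rw [← h, act_inv_act]

theorem act_inv_fixed {g : Γ.Collineation} {y : P ⊕ L} (h : g.act y = y) : g⁻¹.act y = y :=
  act_inv_eq h

theorem eq_one_of_forall {g : Γ.Collineation} (h : ∀ y, g.act y = y) : g = 1 := by
  apply Subtype.ext
  apply Prod.ext
  · ext p
    have := h (Sum.inl p)
    simpa [act] using this
  · ext l
    have := h (Sum.inr l)
    simpa [act] using this

theorem adj_act (g : Γ.Collineation) {x y : P ⊕ L} (h : Γ.incGraph.Adj x y) :
    Γ.incGraph.Adj (g.act x) (g.act y) := by
  rcases h with ⟨p, l, rfl, rfl, h⟩ | ⟨p, l, rfl, rfl, h⟩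
  · exact Or.inl ⟨_, _, rfl, rfl, (g.2 p l).2 h⟩
  · exact Or.inr ⟨_, _, rfl, rfl, (g.2 p l).2 h⟩

/-- A collineation as an endomorphism of the incidence graph. -/
def toHom (g : Γ.Collineation) : Γ.incGraph →g Γ.incGraph := ⟨g.act, g.adj_act⟩

theorem edist_act_le (g : Γ.Collineation) (x y : P ⊕ L) :
    Γ.incGraph.edist (g.act x) (g.act y) ≤ Γ.incGraph.edist x y := by
  by_cases h : Γ.incGraph.Reachable x y
  · obtain ⟨p, hp⟩ := h.exists_walk_length_eq_edist
    rw [← hp, ← SimpleGraph.Walk.length_map g.toHom p]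
    exact SimpleGraph.edist_le (p.map g.toHom)
  · rw [SimpleGraph.edist_eq_top_of_not_reachable h]
    exact le_top

theorem edist_act (g : Γ.Collineation) (x y : P ⊕ L) :
    Γ.incGraph.edist (g.act x) (g.act y) = Γ.incGraph.edist x y := by
  refine le_antisymm (g.edist_act_le x y) ?_
  have := g⁻¹.edist_act_le (g.act x) (g.act y)
  rwa [act_inv_act, act_inv_act] at this

theorem dist_act (g : Γ.Collineation) (x y : P ⊕ L) :
    Γ.incGraph.dist (g.act x) (g.act y) = Γ.incGraph.dist x y := by
  rw [SimpleGraph.dist, edist_act, SimpleGraph.dist]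

end Collineation

/-! ### Distances in generalised hexagons -/

/-- The colouring of the incidence graph by the type of an element. -/
def typeColoring (Γ : PointLineGeometry P L) : Γ.incGraph.Coloring Bool :=
  SimpleGraph.Coloring.mk Sum.isLeft (by
    rintro x y (⟨p, l, rfl, rfl, -⟩ | ⟨p, l, rfl, rfl, -⟩) <;> simp)

theorem isLeft_ne_of_adj {x y : P ⊕ L} (h : Γ.incGraph.Adj x y) : x.isLeft ≠ y.isLeft :=
  Γ.typeColoring.valid h

theorem IsApartment.adj_natCast {c : ZMod 12 → P ⊕ L} (hc : Γ.IsApartment c) (i : ZMod 12)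
    (n : ℕ) : Γ.incGraph.Adj (c (i + n)) (c (i + (n + 1 : ℕ))) := by
  have := hc.2 (i + n)
  rwa [add_assoc, ← Nat.cast_one, ← Nat.cast_add] at this

namespace IsGeneralizedHexagon

variable (hΓ : Γ.IsGeneralizedHexagon)
include hΓ

theorem exists_walk_length_le_six (x y : P ⊕ L) : ∃ p : Γ.incGraph.Walk x y, p.length ≤ 6 := by
  obtain ⟨c, hc, ⟨i, rfl⟩, ⟨j, rfl⟩⟩ := hΓ.exists_apartment x y
  have key : ∀ (n : ℕ) (i : ZMod 12),
      ∃ p : Γ.incGraph.Walk (c i) (c (i + n)), p.length = n := by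
    intro n i
    induction n with
    | zero => exact ⟨SimpleGraph.Walk.nil.copy rfl (by simp), by simp⟩
    | succ n ih =>
      obtain ⟨p, hp⟩ := ih
      exact ⟨p.concat (hc.adj_natCast i n), by simp [hp]⟩
  by_cases h : (j - i).val ≤ 6
  · obtain ⟨p, hp⟩ := key (j - i).val i
    have e : i + ((j - i).val : ZMod 12) = j := by simp
    exact ⟨p.copy rfl (by rw [e]), by simpa [hp] using h⟩
  · obtain ⟨p, hp⟩ := key (i - j).val j
    have e : j + ((i - j).val : ZMod 12) = i := by simp
    refine ⟨(p.copy rfl (by rw [e])).reverse, ?_⟩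
    have : (i - j).val ≤ 6 := by
      have h0 : j - i ≠ 0 := by
        intro h0
        rw [h0] at h
        simp at h
      rw [← neg_sub j i, ZMod.neg_val, if_neg h0]
      omega
    simpa [hp] using this

theorem connected : Γ.incGraph.Connected :=
  haveI := hΓ.nonempty
  ⟨fun x y => (hΓ.exists_walk_length_le_six x y).elim fun p _ => ⟨p⟩⟩

theorem dist_le_six (x y : P ⊕ L) : Γ.incGraph.dist x y ≤ 6 := by
  obtain ⟨p, hp⟩ := hΓ.exists_walk_length_le_six x y
  exact (SimpleGraph.dist_le p).trans hp

theorem edist_le_three_iff {x y : P ⊕ L} :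
    Γ.incGraph.edist x y ≤ 3 ↔ Γ.incGraph.dist x y ≤ 3 := by
  rw [← (hΓ.connected x y).coe_dist_eq_edist]
  exact_mod_cast Iff.rfl

/-- Adjacent elements have different types and the incidence graph is bipartite, so their distances
from `v` have different parities. -/
theorem dist_adj {x y : P ⊕ L} (v : P ⊕ L) (h : Γ.incGraph.Adj x y) :
    Γ.incGraph.dist v y = Γ.incGraph.dist v x + 1 ∨
      Γ.incGraph.dist v x = Γ.incGraph.dist v y + 1 := by
  obtain ⟨p, hp⟩ := hΓ.connected.exists_walk_length_eq_dist v x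
  obtain ⟨q, hq⟩ := hΓ.connected.exists_walk_length_eq_dist v y
  have h1 := Γ.typeColoring.even_length_iff_congr p
  have h2 := Γ.typeColoring.even_length_iff_congr q
  have h3 := Γ.typeColoring.valid h
  rw [hp] at h1
  rw [hq] at h2
  have h4 : ¬ (Even (Γ.incGraph.dist v x) ↔ Even (Γ.incGraph.dist v y)) := by
    rw [h1, h2]
    cases h5 : Γ.typeColoring v <;> cases h6 : Γ.typeColoring x <;>
      cases h7 : Γ.typeColoring y <;> simp_all
  have h5 := hΓ.connected.dist_triangle (u := v) (v := x) (w := y)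
  have h6 := hΓ.connected.dist_triangle (u := v) (v := y) (w := x)
  rw [SimpleGraph.dist_eq_one_iff_adj.2 h] at h5
  rw [SimpleGraph.dist_eq_one_iff_adj.2 h.symm] at h6
  rw [Nat.even_iff, Nat.even_iff] at h4
  omega

theorem exists_geodesic (x y : P ⊕ L) : ∃ p : ℕ → P ⊕ L, p 0 = x ∧
    p (Γ.incGraph.dist x y) = y ∧
    (∀ i < Γ.incGraph.dist x y, Γ.incGraph.Adj (p i) (p (i + 1))) ∧
    (∀ i ≤ Γ.incGraph.dist x y, Γ.incGraph.dist x (p i) = i ∧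
      Γ.incGraph.dist (p i) y = Γ.incGraph.dist x y - i) := by
  obtain ⟨p, hp⟩ := hΓ.connected.exists_walk_length_eq_dist x y
  refine ⟨p.getVert, p.getVert_zero, by rw [← hp, p.getVert_length], fun i hi =>
    p.adj_getVert_succ (by omega), fun i hi => ?_⟩
  have h1 := SimpleGraph.dist_le (p.take i)
  have h2 := SimpleGraph.dist_le (p.drop i)
  have h3 := hΓ.connected.dist_triangle (u := x) (v := p.getVert i) (w := y)
  rw [SimpleGraph.Walk.take_length] at h1
  rw [SimpleGraph.Walk.drop_length] at h2
  omega

/-- Two geodesics from `v` to `x` arriving through different neighbours would form an ordinary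
`k`-gon with `k = dist v x ≤ 5`. If they meet earlier, the meeting point replaces `v` and the
induction applies. This provides the projection of `v` onto `x` whenever they are not opposite. -/
theorem closer_unique {v x y₁ y₂ : P ⊕ L} (hx : Γ.incGraph.dist v x ≤ 5)
    (h₁ : Γ.incGraph.Adj x y₁) (h₂ : Γ.incGraph.Adj x y₂)
    (d₁ : Γ.incGraph.dist v y₁ + 1 = Γ.incGraph.dist v x)
    (d₂ : Γ.incGraph.dist v y₂ + 1 = Γ.incGraph.dist v x) : y₁ = y₂ := by
  obtain ⟨k, hk⟩ : ∃ k, Γ.incGraph.dist v x = k := ⟨_, rfl⟩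
  induction k using Nat.strong_induction_on generalizing v with
  | _ k ih =>
    by_contra hne
    have hk0 : k ≠ 0 := by omega
    by_cases hk1 : k = 1
    · have e₁ : Γ.incGraph.dist v y₁ = 0 := by omega
      have e₂ : Γ.incGraph.dist v y₂ = 0 := by omega
      rw [hΓ.connected.dist_eq_zero_iff] at e₁ e₂
      exact hne (e₁.symm.trans e₂)
    have hk2 : 2 ≤ k := by omega
    have e₁ : Γ.incGraph.dist v y₁ = k - 1 := by omega
    have e₂ : Γ.incGraph.dist v y₂ = k - 1 := by omega
    obtain ⟨p, p0, pk, padj, pd⟩ := hΓ.exists_geodesic v y₁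
    obtain ⟨q, q0, qk, qadj, qd⟩ := hΓ.exists_geodesic v y₂
    rw [e₁] at pk padj pd
    rw [e₂] at qk qadj qd
    have hpq : ∀ i, 1 ≤ i → i ≤ k - 1 → p i ≠ q i := by
      intro i hi1 hi2 he
      have d1 := (pd i hi2).2
      have d2 := (qd i hi2).2
      rw [← he] at d2
      have h3 := hΓ.connected.dist_triangle (u := v) (v := p i) (w := x)
      have h4 := hΓ.dist_adj (p i) h₁
      have h5 := (pd i hi2).1
      exact hne (ih (k - i) (by omega) (v := p i) (by omega) (by omega) (by omega) (by omega))
    have : NeZero (2 * k) := ⟨by omega⟩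
    have : Fact (1 < 2 * k) := ⟨by omega⟩
    -- The circuit goes up `p` from `v` to `y₁`, passes `x` at index `k`, and comes back down `q`.
    -- The distance from `v` determines an index up to `j ↔ 2k - j`, and `hpq` separates these two
    -- positions.
    let c : ZMod (2 * k) → P ⊕ L := fun j =>
      if j.val < k then p j.val else if j.val = k then x else q (2 * k - j.val)
    refine hΓ.no_small_polygon k hk2 (by omega) c ⟨?_, ?_⟩
    · intro j j' hjj
      have hj := j.val_lt
      have hj' := j'.val_lt
      apply ZMod.val_injective
      have hdist : ∀ j : ZMod (2 * k), Γ.incGraph.dist v (c j) =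
          if j.val ≤ k then j.val else 2 * k - j.val := by
        intro j
        have hj := j.val_lt
        simp only [c]
        split_ifs with h1 h2 h3 h4
        · exact (pd _ (by omega)).1
        · omega
        · omega
        · omega
        · omega
        · exact (qd _ (by omega)).1
      have hd : Γ.incGraph.dist v (c j) = Γ.incGraph.dist v (c j') := by rw [hjj]
      rw [hdist, hdist] at hd
      have hcase : j.val = j'.val ∨ (j.val + j'.val = 2 * k ∧ j.val ≠ k) := by
        split_ifs at hd <;> omega
      rcases hcase with h | ⟨h, h'⟩
      · exact h
      · exfalso
        rcases lt_or_gt_of_ne h' with hlt | hgt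
        · have e : 2 * k - j'.val = j.val := by omega
          simp only [c, if_pos hlt, if_neg (show ¬ j'.val < k by omega),
            if_neg (show ¬ j'.val = k by omega), e] at hjj
          exact hpq _ (by omega) (by omega) hjj
        · have e : 2 * k - j.val = j'.val := by omega
          simp only [c, if_neg (show ¬ j.val < k by omega), if_neg h',
            if_pos (show j'.val < k by omega), e] at hjj
          exact hpq _ (by omega) (by omega) hjj.symm
    · intro j
      have hj := j.val_lt
      by_cases hlast : j.val + 1 < 2 * k
      · have e : (j + 1).val = j.val + 1 := by
          rw [ZMod.val_add, ZMod.val_one, Nat.mod_eq_of_lt hlast]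
        simp only [c, e]
        rcases lt_trichotomy (j.val + 1) k with h | h | h
        · rw [if_pos (by omega), if_pos h]
          exact padj _ (by omega)
        · rw [if_pos (by omega), if_neg (by omega), if_pos h, show j.val = k - 1 by omega, pk]
          exact h₁.symm
        · rw [if_neg (show ¬ j.val < k by omega), if_neg (show ¬ j.val + 1 < k by omega),
            if_neg (show ¬ j.val + 1 = k by omega)]
          split_ifs with h5
          · rw [show 2 * k - (j.val + 1) = k - 1 by omega, qk]
            exact h₂
          · have := qadj (2 * k - (j.val + 1)) (by omega)
            rw [show 2 * k - (j.val + 1) + 1 = 2 * k - j.val by omega] at this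
            exact this.symm
      · have e : (j + 1).val = 0 := by
          rw [ZMod.val_add, ZMod.val_one, show j.val + 1 = 2 * k by omega, Nat.mod_self]
        simp only [c, e]
        rw [if_neg (by omega), if_neg (by omega), if_pos (by omega), p0, ← q0,
          show 2 * k - j.val = 0 + 1 by omega]
        exact (qadj 0 (by omega)).symm

theorem dist_eq_succ {v x y y' : P ⊕ L} (hx : Γ.incGraph.dist v x ≤ 5)
    (h : Γ.incGraph.Adj x y) (h' : Γ.incGraph.Adj x y')
    (d : Γ.incGraph.dist v y + 1 = Γ.incGraph.dist v x) (hne : y' ≠ y) :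
    Γ.incGraph.dist v y' = Γ.incGraph.dist v x + 1 := by
  rcases hΓ.dist_adj v h' with e | e
  · exact e
  · exact absurd (hΓ.closer_unique hx h' h e.symm d) hne

theorem exists_closer {v x : P ⊕ L} (hne : v ≠ x) :
    ∃ y, Γ.incGraph.Adj x y ∧ Γ.incGraph.dist v y + 1 = Γ.incGraph.dist v x := by
  obtain ⟨p, p0, pk, padj, pd⟩ := hΓ.exists_geodesic v x
  have h0 : 0 < Γ.incGraph.dist v x := hΓ.connected.pos_dist_of_ne hne
  refine ⟨p (Γ.incGraph.dist v x - 1), ?_, ?_⟩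
  · have := padj (Γ.incGraph.dist v x - 1) (by omega)
    rw [Nat.sub_add_cancel h0, pk] at this
    exact this.symm
  · rw [(pd _ (Nat.sub_le _ _)).1]
    omega

/-- A path that never backtracks moves away from its start until distance 6, because the only
neighbour nearer the start is the one just left. -/
theorem dist_apartment {c : ZMod 12 → P ⊕ L} (hc : Γ.IsApartment c) (i : ZMod 12) (n : ℕ)
    (hn : n ≤ 6) : Γ.incGraph.dist (c i) (c (i + n)) = n := by
  induction n using Nat.strong_induction_on with
  | _ n ih =>
    match n, ih, hn with
    | 0, _, _ => simp
    | 1, _, _ =>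
      rw [SimpleGraph.dist_eq_one_iff_adj, Nat.cast_one]
      exact hc.2 i
    | n + 2, ih, hn =>
      have h1 := ih n (by omega) (by omega)
      have h2 := ih (n + 1) (by omega) (by omega)
      have := hΓ.dist_eq_succ (v := c i) (by omega) (hc.adj_natCast i n).symm
        (hc.adj_natCast i (n + 1)) (by omega) (fun h => by
          have h3 := hc.1 h
          rw [add_right_inj] at h3
          have h4 : (2 : ZMod 12) = 0 := by
            push_cast at h3
            linear_combination h3
          exact absurd h4 (by decide))
      rwa [h2] at this

end IsGeneralizedHexagon

end PointLineGeometry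

namespace PointLineGeometry

variable {P : Type w} {L : Type z} {Γ : PointLineGeometry P L}

/-! ### Rigidity -/

namespace Collineation

/-- `θ` fixes `x` and all elements incident with `x`. -/
def FixesStar (θ : Γ.Collineation) (x : P ⊕ L) : Prop :=
  θ.act x = x ∧ ∀ y, Γ.incGraph.Adj x y → θ.act y = y

/-- `θ` fixes all elements at distance at most `3` from `x`. -/
def FixesBall (θ : Γ.Collineation) (x : P ⊕ L) : Prop :=
  ∀ y, Γ.incGraph.dist x y ≤ 3 → θ.act y = y

theorem FixesBall.conj {θ : Γ.Collineation} {x : P ⊕ L} (h : θ.FixesBall x)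
    (g : Γ.Collineation) : (g * θ * g⁻¹).FixesBall (g.act x) := by
  intro y hy
  rw [act_mul, act_mul, h, act_act_inv]
  rwa [← g.dist_act, act_act_inv]

theorem FixesBall.mul {θ θ' : Γ.Collineation} {x : P ⊕ L} (h : θ.FixesBall x)
    (h' : θ'.FixesBall x) : (θ * θ').FixesBall x := by
  intro y hy
  rw [act_mul, h' y hy, h y hy]

theorem FixesBall.inv {θ : Γ.Collineation} {x : P ⊕ L} (h : θ.FixesBall x) :
    (θ⁻¹).FixesBall x :=
  fun y hy => act_inv_fixed (h y hy)

theorem FixesBall.conj_of_fixed {θ : Γ.Collineation} {x : P ⊕ L} (h : θ.FixesBall x)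
    {g : Γ.Collineation} (hg : g.act x = x) : (g⁻¹ * θ * g).FixesBall x := by
  have := h.conj g⁻¹
  rwa [inv_inv, act_inv_fixed hg] at this

end Collineation

theorem IsThick.exists_adj_ne (h : Γ.IsThick) (x a b : P ⊕ L) :
    ∃ y, Γ.incGraph.Adj x y ∧ y ≠ a ∧ y ≠ b := by
  by_contra! hcon
  have hsub : Γ.incGraph.neighborSet x ⊆ {a, b} := by
    intro y hy
    by_cases hya : y = a
    · exact Or.inl hya
    · exact Or.inr (hcon y hy hya)
  have h1 := (h x).trans (Set.encard_le_encard hsub)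
  have h2 := h1.trans (Set.encard_insert_le {b} a)
  rw [Set.encard_singleton, one_add_one_eq_two] at h2
  exact absurd h2 (by decide)

theorem IsApartment.neg {c : ZMod 12 → P ⊕ L} (hc : Γ.IsApartment c) :
    Γ.IsApartment (fun j => c (-j)) := by
  refine ⟨hc.1.comp neg_injective, fun i => ?_⟩
  have := (hc.2 (-(i + 1))).symm
  rwa [show -(i + 1) + 1 = -i by ring] at this

theorem mem_rootGroup_neg_iff {c : ZMod 12 → P ⊕ L} {i : ZMod 12} {θ : Γ.Collineation} :
    θ ∈ Γ.rootGroup (fun j => c (-j)) (-i - 6) ↔ θ ∈ Γ.rootGroup c i := by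
  constructor
  · intro h k h1 h5 y hy
    refine h (6 - k) (by omega) (by omega) y ?_
    rw [Nat.cast_sub (by omega)]
    convert hy using 2
    push_cast
    ring
  · intro h k h1 h5 y hy
    refine h (6 - k) (by omega) (by omega) y ?_
    rw [Nat.cast_sub (by omega)]
    convert hy using 2
    push_cast
    ring

theorem IsApartment.rootGroup_fixes {c : ZMod 12 → P ⊕ L} (hc : Γ.IsApartment c) {i : ZMod 12}
    {θ : Γ.Collineation} (h : θ ∈ Γ.rootGroup c i) (k : ℕ) (hk : k ≤ 6) :
    θ.act (c (i + k)) = c (i + k) := by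
  by_cases h1 : k ≤ 4
  · exact h (k + 1) (by omega) (by omega) _ (hc.adj_natCast i k).symm
  · obtain ⟨k, rfl⟩ : ∃ m, k = m + 1 := ⟨k - 1, by omega⟩
    exact h k (by omega) (by omega) _ (hc.adj_natCast i k)

theorem IsApartment.rootGroup_fixesStar {c : ZMod 12 → P ⊕ L} (hc : Γ.IsApartment c)
    {i : ZMod 12} {θ : Γ.Collineation} (h : θ ∈ Γ.rootGroup c i) (k : ℕ) (h1 : 1 ≤ k)
    (h5 : k ≤ 5) : θ.FixesStar (c (i + k)) :=
  ⟨hc.rootGroup_fixes h k (by omega), h k h1 h5⟩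

namespace IsGeneralizedHexagon

open Collineation

variable (hΓ : Γ.IsGeneralizedHexagon)
include hΓ

theorem fixed_closer {θ : Γ.Collineation} {v x y : P ⊕ L} (hv : θ.act v = v) (hx : θ.act x = x)
    (hd : Γ.incGraph.dist v x ≤ 5) (h : Γ.incGraph.Adj x y)
    (d : Γ.incGraph.dist v y + 1 = Γ.incGraph.dist v x) : θ.act y = y := by
  have h1 := θ.adj_act h
  have h2 := θ.dist_act v y
  rw [hx] at h1
  rw [hv] at h2
  exact hΓ.closer_unique hd h1 h (by omega) d

/-- Projection matches the neighbours of two opposite elements: each neighbour of `y` is the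
projection onto `y` of a neighbour of `x`, which is fixed. -/
theorem fixesStar_of_opposite {θ : Γ.Collineation} {x y : P ⊕ L} (hx : θ.FixesStar x)
    (hy : θ.act y = y) (hd : Γ.incGraph.dist x y = 6) : θ.FixesStar y := by
  refine ⟨hy, fun z hz => ?_⟩
  have d1 : Γ.incGraph.dist x z = 5 := by
    have := hΓ.dist_adj x hz
    have := hΓ.dist_le_six x z
    omega
  obtain ⟨y', h1, h2⟩ := hΓ.exists_closer (v := z) (x := x) (by
    rintro rfl
    simp at d1)
  have h3 := hΓ.dist_adj y h1
  have h4 := hΓ.dist_le_six y y'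
  rw [SimpleGraph.dist_comm (v := x), SimpleGraph.dist_comm (v := y')] at h3
  rw [SimpleGraph.dist_comm (v := x), SimpleGraph.dist_comm (v := y'), d1] at h2
  rw [SimpleGraph.dist_comm] at h4
  exact hΓ.fixed_closer (hx.2 y' h1) hy (by omega) hz (by omega)

/-- A third element `y` incident with `v'` is opposite both `w` and `z`, so the fixed star passes
from `w` to `y` and from `y` to `z`. The element `y` also serves as a fixed opposite of `z`, so the
hypotheses hold again at `z`. -/
theorem fixesStar_adj (ht : Γ.IsThick) {θ : Γ.Collineation} {v w v' z : P ⊕ L}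
    (hv : θ.FixesStar v) (hw : θ.FixesStar w) (hvw : Γ.incGraph.Adj v w) (hv' : θ.act v' = v')
    (hd : Γ.incGraph.dist v v' = 6) (hz : Γ.incGraph.Adj v z) :
    θ.FixesStar z ∧ ∃ z', θ.act z' = z' ∧ Γ.incGraph.dist z z' = 6 := by
  have key : ∀ z, Γ.incGraph.Adj v z → ∃ e, ∀ y, Γ.incGraph.Adj v' y → y ≠ e →
      Γ.incGraph.dist z y = 6 := by
    intro z hz
    have h1 := hΓ.dist_adj v' hz
    have h2 := hΓ.dist_le_six v' z
    rw [SimpleGraph.dist_comm (v := v), SimpleGraph.dist_comm (v := z)] at h1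
    rw [SimpleGraph.dist_comm] at h2
    have h5 : Γ.incGraph.dist z v' = 5 := by omega
    obtain ⟨e, he, hed⟩ := hΓ.exists_closer (v := z) (x := v') (by
      rintro rfl
      simp at h5)
    refine ⟨e, fun y hy hne => ?_⟩
    have := hΓ.dist_eq_succ (v := z) (by omega) he hy hed hne
    omega
  obtain ⟨e, he⟩ := key z hz
  obtain ⟨e', he'⟩ := key w hvw
  obtain ⟨y, hy, hye, hye'⟩ := ht.exists_adj_ne v' e e'
  have hs := hΓ.fixesStar_of_opposite hv hv' hd
  have hsy := hΓ.fixesStar_of_opposite hw (hs.2 y hy) (he' y hy hye')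
  exact ⟨hΓ.fixesStar_of_opposite hsy (hv.2 z hz)
    (by rw [SimpleGraph.dist_comm]; exact he y hy hye), y, hs.2 y hy, he y hy hye⟩

/-- A collineation fixing the stars of two adjacent elements and an element opposite one of
them is trivial. -/
theorem eq_one_of_fixesStar (ht : Γ.IsThick) {θ : Γ.Collineation} {v w v' : P ⊕ L}
    (hv : θ.FixesStar v) (hw : θ.FixesStar w) (hvw : Γ.incGraph.Adj v w) (hv' : θ.act v' = v')
    (hd : Γ.incGraph.dist v v' = 6) : θ = 1 := by
  -- The property carried along a walk from `v` is: fixed star here, fixed star at some neighbour,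
  -- and some fixed opposite element.
  have key : ∀ {x y : P ⊕ L} (p : Γ.incGraph.Walk x y),
      (θ.FixesStar x ∧ (∃ w, Γ.incGraph.Adj x w ∧ θ.FixesStar w) ∧
        ∃ x', θ.act x' = x' ∧ Γ.incGraph.dist x x' = 6) → θ.act y = y := by
    intro x y p
    induction p with
    | nil => exact fun h => h.1.1
    | cons h p ih =>
      rintro ⟨h1, ⟨w, h2, h3⟩, ⟨x', h4, h5⟩⟩
      obtain ⟨h6, h7⟩ := hΓ.fixesStar_adj ht h1 h3 h2 h4 h5 h
      exact ih ⟨h6, ⟨_, h.symm, h1⟩, h7⟩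
  refine eq_one_of_forall fun y => ?_
  obtain ⟨p⟩ := hΓ.connected v y
  exact key p ⟨hv, ⟨w, hvw, hw⟩, v', hv', hd⟩

/-- Freeness of the root group: the element `i + 7` is opposite the interior element `i + 1`, whose
star is fixed together with that of `i + 2`. -/
theorem rootGroup_eq_one (ht : Γ.IsThick) {c : ZMod 12 → P ⊕ L} (hc : Γ.IsApartment c)
    {i : ZMod 12} {θ : Γ.Collineation} (h : θ ∈ Γ.rootGroup c i)
    (h7 : θ.act (c (i + 7)) = c (i + 7)) : θ = 1 := by
  have hd := hΓ.dist_apartment hc (i + (1 : ℕ)) 6 le_rfl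
  refine hΓ.eq_one_of_fixesStar ht (hc.rootGroup_fixesStar h 1 le_rfl (by norm_num))
    (hc.rootGroup_fixesStar h 2 (by norm_num) (by norm_num)) (hc.adj_natCast i 1) h7 ?_
  rwa [show i + ((1 : ℕ) : ZMod 12) + ((6 : ℕ) : ZMod 12) = i + 7 by push_cast; ring] at hd

theorem fixesStar_of_fixesBall {θ : Γ.Collineation} {l x : P ⊕ L} (h : θ.FixesBall l)
    (hx : Γ.incGraph.dist l x ≤ 2) : θ.FixesStar x := by
  refine ⟨h x (by omega), fun y hy => h y ?_⟩
  have := hΓ.dist_adj l hy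
  omega

/-- Two steps from `l` away from `n` lead to an element `v` opposite `n`. It and the intermediate
`w` lie within distance 2 of `l`, so their stars are fixed and rigidity applies. -/
theorem eq_one_of_fixesBall (ht : Γ.IsThick) {θ : Γ.Collineation} {l n : P ⊕ L}
    (h : θ.FixesBall l) (hd : Γ.incGraph.dist l n = 4) (hn : θ.act n = n) : θ = 1 := by
  rw [SimpleGraph.dist_comm] at hd
  obtain ⟨e, he, hed⟩ := hΓ.exists_closer (v := n) (x := l) (by
    rintro rfl
    simp at hd)
  obtain ⟨w, hw, hwe, -⟩ := ht.exists_adj_ne l e e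
  have hdw := hΓ.dist_eq_succ (v := n) (by omega) he hw hed hwe
  obtain ⟨v, hv, hvl, -⟩ := ht.exists_adj_ne w l l
  have hdv := hΓ.dist_eq_succ (v := n) (by omega) hw.symm hv (by omega) hvl
  have hlw := SimpleGraph.dist_eq_one_iff_adj.2 hw
  have hlv := hΓ.dist_adj l hv
  refine hΓ.eq_one_of_fixesStar ht (hΓ.fixesStar_of_fixesBall h (x := v) (by omega))
    (hΓ.fixesStar_of_fixesBall h (x := w) (by omega)) hv.symm hn ?_
  rw [SimpleGraph.dist_comm]
  omega

/-- A fixed element at distance 5 or 6 projects to a fixed element one step nearer, so everything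
comes down to distance 4. At distance 6 there is no projection from `l`, and a neighbour `p` of `l`
is used instead. -/
theorem fixed_iff_of_fixesBall (ht : Γ.IsThick) {θ : Γ.Collineation} {l : P ⊕ L}
    (h : θ.FixesBall l) (hne : θ ≠ 1) (x : P ⊕ L) :
    θ.act x = x ↔ Γ.incGraph.dist l x ≤ 3 := by
  refine ⟨fun hx => ?_, h x⟩
  have four : ∀ x, θ.act x = x → Γ.incGraph.dist l x ≠ 4 :=
    fun x hx hd => hne (hΓ.eq_one_of_fixesBall ht h hd hx)
  have five : ∀ x, θ.act x = x → Γ.incGraph.dist l x ≠ 5 := by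
    intro x hx hd
    obtain ⟨y, hy, hyd⟩ := hΓ.exists_closer (v := l) (x := x) (by
      rintro rfl
      simp at hd)
    exact four y (hΓ.fixed_closer (h l (by simp)) hx (by omega) hy hyd) (by omega)
  have six : Γ.incGraph.dist l x ≠ 6 := by
    intro hd
    obtain ⟨p, hp, -⟩ := ht.exists_adj_ne l l l
    have hlp := SimpleGraph.dist_eq_one_iff_adj.2 hp
    have hpx := hΓ.dist_adj x hp
    rw [SimpleGraph.dist_comm (v := l), SimpleGraph.dist_comm (v := p)] at hpx
    have hle := hΓ.dist_le_six p x
    obtain ⟨q, hq, hqd⟩ := hΓ.exists_closer (v := p) (x := x) (by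
      rintro rfl
      simp at hpx
      omega)
    have hqf := hΓ.fixed_closer (h p (by omega)) hx (by omega) hq hqd
    have htri := hΓ.connected.dist_triangle (u := l) (v := p) (w := q)
    have hlq := hΓ.dist_adj l hq
    exact five q hqf (by omega)
  have := four x hx
  have := five x hx
  have := hΓ.dist_le_six l x
  omega

theorem mem_rootGroup_of_fixesBall {c : ZMod 12 → P ⊕ L} (hc : Γ.IsApartment c) {i : ZMod 12}
    {θ : Γ.Collineation} (h : θ.FixesBall (c (i + 3))) : θ ∈ Γ.rootGroup c i := by
  intro k h1 h5 y hy
  refine (hΓ.fixesStar_of_fixesBall h ?_).2 y hy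
  by_cases h3 : k ≤ 3
  · have := hΓ.dist_apartment hc (i + k) (3 - k) (by omega)
    rw [show i + (k : ZMod 12) + ((3 - k : ℕ) : ZMod 12) = i + 3 by
      rw [Nat.cast_sub h3]; push_cast; ring] at this
    rw [SimpleGraph.dist_comm]
    omega
  · have := hΓ.dist_apartment hc (i + 3) (k - 3) (by omega)
    rw [show i + 3 + ((k - 3 : ℕ) : ZMod 12) = i + k by
      rw [Nat.cast_sub (by omega)]; push_cast; ring] at this
    omega

/-- A root is determined by its end elements and the element following the first of them. -/
theorem apartment_eq_of_corner {c : ZMod 12 → P ⊕ L} (hc : Γ.IsApartment c) {c' : ZMod 12 → P ⊕ L}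
    (hc' : Γ.IsApartment c') {j : ZMod 12} (h0 : c j = c' j) (h1 : c (j + 1) = c' (j + 1))
    (h6 : c (j + 6) = c' (j + 6)) (n : ℕ) (hn : n ≤ 6) : c (j + n) = c' (j + n) := by
  have hdist : ∀ {c : ZMod 12 → P ⊕ L}, Γ.IsApartment c → ∀ n : ℕ, n ≤ 6 →
      Γ.incGraph.dist (c (j + 6)) (c (j + n)) = 6 - n := by
    intro c hc n hn
    have := hΓ.dist_apartment hc (j + n) (6 - n) (by omega)
    rw [show j + (n : ZMod 12) + ((6 - n : ℕ) : ZMod 12) = j + 6 by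
      rw [Nat.cast_sub hn]; push_cast; ring] at this
    rw [SimpleGraph.dist_comm, this]
  induction n with
  | zero => simpa using h0
  | succ n ih =>
    rcases Nat.eq_zero_or_pos n with rfl | hpos
    · simpa using h1
    · have ih := ih (by omega)
      have a1 := hc.adj_natCast j n
      have a2 := hc'.adj_natCast j n
      have d1 := hdist hc n (by omega)
      have d2 := hdist hc (n + 1) hn
      have d3 := hdist hc' (n + 1) hn
      rw [← ih] at a2
      rw [← h6] at d3
      exact hΓ.closer_unique (v := c (j + 6)) (by omega) a1 a2 (by omega) (by omega)

end IsGeneralizedHexagon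

namespace IsApartment

theorem act {c : ZMod 12 → P ⊕ L} (hc : Γ.IsApartment c) (g : Γ.Collineation) :
    Γ.IsApartment (fun j => g.act (c j)) :=
  ⟨g.act_injective.comp hc.1, fun i => g.adj_act (hc.2 i)⟩

theorem shift {c : ZMod 12 → P ⊕ L} (hc : Γ.IsApartment c) (k : ZMod 12) :
    Γ.IsApartment (fun j => c (k + j)) := by
  refine ⟨hc.1.comp (add_right_injective k), fun i => ?_⟩
  have := hc.2 (k + i)
  rwa [add_assoc] at this

end IsApartment

/-! ### Reflections of apartments -/

/-- Reflections of an apartment carry root groups to root groups. -/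
theorem conj_mem_rootGroup {c : ZMod 12 → P ⊕ L} {i k k' : ZMod 12} {g θ : Γ.Collineation}
    (hg : ∀ j, g.act (c j) = c (i - j)) (hk : k' = i - k - 6) (hθ : θ ∈ Γ.rootGroup c k') :
    g⁻¹ * θ * g ∈ Γ.rootGroup c k := by
  intro n h1 h5 y hy
  have := g.adj_act hy
  rw [hg] at this
  rw [Collineation.act_mul, Collineation.act_mul, hθ (6 - n) (by omega) (by omega) (g.act y), 
    Collineation.act_inv_act]
  rw [Nat.cast_sub (by omega), hk]
  convert this using 2
  push_cast
  ring

namespace IsMoufangHexagon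

open Collineation

variable (hΓ : Γ.IsMoufangHexagon)
include hΓ

theorem moufang_end {c : ZMod 12 → P ⊕ L} (hc : Γ.IsApartment c) (i : ZMod 12) {y y' : P ⊕ L}
    (hy : Γ.incGraph.Adj (c (i + 6)) y) (hne : y ≠ c (i + 5))
    (hy' : Γ.incGraph.Adj (c (i + 6)) y') (hne' : y' ≠ c (i + 5)) :
    ∃ θ ∈ Γ.rootGroup c i, θ.act y = y' := by
  have e6 : -(-i - 6) = i + 6 := by ring
  have e5 : -(-i - 6 + 1) = i + 5 := by ring
  obtain ⟨θ, hθ, h⟩ := hΓ.moufang _ hc.neg (-i - 6) y y' (by rwa [e6]) (by rwa [e5])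
    (by rwa [e6]) (by rwa [e5])
  exact ⟨θ, mem_rootGroup_neg_iff.1 hθ, h⟩

/-- The usual construction of a reflection from opposite root groups: the product fixes `i` and `i +
6` and exchanges `i + 5` with `i + 7`, which determines its effect on both halves of the apartment.
-/
theorem exists_reflection_of_mem {c : ZMod 12 → P ⊕ L} (hc : Γ.IsApartment c) {i : ZMod 12}
    {x : Γ.Collineation} (hx : x ∈ Γ.rootGroup c i) (hne : x.act (c (i + 7)) ≠ c (i + 7)) :
    ∃ y ∈ Γ.rootGroup c (i + 6), ∃ y' ∈ Γ.rootGroup c (i + 6),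
      ∀ j, (y * x * y').act (c j) = c (2 * i - j) := by
  have e56 : Γ.incGraph.Adj (c (i + 6)) (c (i + 5)) := by
    have := (hc.2 (i + 5)).symm
    rwa [show i + 5 + 1 = i + 6 by ring] at this
  have e67 : Γ.incGraph.Adj (c (i + 6)) (c (i + 7)) := by
    have := hc.2 (i + 6)
    rwa [show i + 6 + 1 = i + 7 by ring] at this
  have e7 : i + 6 + 1 = i + 7 := by ring
  have h57 : c (i + 5) ≠ c (i + 7) := fun h => by
    have := hc.1 h
    rw [add_right_inj] at this
    exact absurd this (by decide)
  have x6 : x.act (c (i + 6)) = c (i + 6) := hc.rootGroup_fixes hx 6 le_rfl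
  have x0 : x.act (c i) = c i := by simpa using hc.rootGroup_fixes hx 0 (by norm_num)
  have ax := x.adj_act e67
  have ax' := x⁻¹.adj_act e67
  rw [x6] at ax
  rw [act_inv_fixed x6] at ax'
  -- Here `y` is chosen so that the product takes `i + 7` to `i + 5`, and `y'` so that it takes `i +
  -- 5` to `i + 7`.
  obtain ⟨y, hy, hyx⟩ := hΓ.moufang c hc (i + 6) (x.act (c (i + 7))) (c (i + 5)) ax
    (by rwa [e7]) e56 (by rwa [e7])
  obtain ⟨y', hy', hyx'⟩ := hΓ.moufang c hc (i + 6) (c (i + 5)) (x⁻¹.act (c (i + 7))) e56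
    (by rwa [e7]) ax' (by
      rw [e7]
      intro h
      apply hne
      conv_lhs => rw [← h, act_act_inv])
  refine ⟨y, hy, y', hy', ?_⟩
  have fix6 : ∀ {y}, y ∈ Γ.rootGroup c (i + 6) → y.act (c (i + 6)) = c (i + 6) := fun hy => by
    simpa using hc.rootGroup_fixes hy 0 (by norm_num)
  have fix7 : ∀ {y}, y ∈ Γ.rootGroup c (i + 6) → y.act (c (i + 7)) = c (i + 7) := fun hy => by
    have := hc.rootGroup_fixes hy 1 (by norm_num)
    rwa [Nat.cast_one, e7] at this
  have e12 : i + 6 + ((6 : ℕ) : ZMod 12) = i := by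
    rw [add_assoc]
    exact add_eq_left.2 (by decide)
  have fix0 : ∀ {y}, y ∈ Γ.rootGroup c (i + 6) → y.act (c i) = c i := fun hy => by
    have := hc.rootGroup_fixes hy 6 le_rfl
    rwa [e12] at this
  set m := y * x * y' with hm
  have m6 : m.act (c (i + 6)) = c (i + 6) := by
    rw [hm, act_mul, act_mul, fix6 hy', x6, fix6 hy]
  have m0 : m.act (c i) = c i := by
    rw [hm, act_mul, act_mul, fix0 hy', x0, fix0 hy]
  have m7 : m.act (c (i + 7)) = c (i + 5) := by
    rw [hm, act_mul, act_mul, fix7 hy', hyx]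
  have m5 : m.act (c (i + 5)) = c (i + 7) := by
    rw [hm, act_mul, act_mul, hyx', act_act_inv, fix7 hy]
  have hup := hΓ.hexagon.apartment_eq_of_corner ((hc.act m).shift (i + 6)) (hc.neg.shift (-(i + 6)))
    (j := 0) (by simpa using m6)
    (by rw [show i + 6 + (0 + 1) = i + 7 by ring, show -(-(i + 6) + (0 + 1)) = i + 5 by ring, m7])
    (by rw [show -(-(i + 6) + (0 + 6)) = i by ring,
        show i + 6 + (0 + 6) = i by linear_combination e12, m0])
  have hdown := hΓ.hexagon.apartment_eq_of_corner ((hc.act m).neg.shift (-(i + 6)))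
    (hc.shift (i + 6)) (j := 0) (by simpa using m6)
    (by rw [show i + 6 + (0 + 1) = i + 7 by ring, show -(-(i + 6) + (0 + 1)) = i + 5 by ring, m5])
    (by rw [show -(-(i + 6) + (0 + 6)) = i by ring,
        show i + 6 + (0 + 6) = i by linear_combination e12, m0])
  have h12 : (12 : ZMod 12) = 0 := by decide
  intro j
  by_cases hj : (j - (i + 6)).val ≤ 6
  · have := hup _ hj
    simp only [ZMod.natCast_val, ZMod.cast_id', id_eq] at this
    rw [show i + 6 + (0 + (j - (i + 6))) = j by ring] at this
    rw [this]
    congr 1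
    linear_combination h12
  · have hval : (i + 6 - j).val ≤ 6 := by
      have h0 : j - (i + 6) ≠ 0 := by
        intro h0
        rw [h0] at hj
        simp at hj
      rw [← neg_sub j, ZMod.neg_val, if_neg h0]
      omega
    have := hdown _ hval
    simp only [ZMod.natCast_val, ZMod.cast_id', id_eq] at this
    rw [show -(-(i + 6) + (0 + (i + 6 - j))) = j by ring] at this
    rw [this]
    congr 1
    linear_combination h12

theorem exists_reflection {c : ZMod 12 → P ⊕ L} (hc : Γ.IsApartment c) (i : ZMod 12) :
    ∃ g : Γ.Collineation, ∀ j, g.act (c j) = c (2 * i - j) := by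
  obtain ⟨y, hy, hy5, hy7⟩ := hΓ.thick.exists_adj_ne (c (i + 6)) (c (i + 5)) (c (i + 7))
  have e67 : Γ.incGraph.Adj (c (i + 6)) (c (i + 7)) := by
    have := hc.2 (i + 6)
    rwa [show i + 6 + 1 = i + 7 by ring] at this
  obtain ⟨x, hx, hxy⟩ := hΓ.moufang_end hc i e67 (fun h => by
    have := hc.1 h
    rw [add_right_inj] at this
    exact absurd this (by decide)) hy hy5
  obtain ⟨z, -, z', -, h⟩ := hΓ.exists_reflection_of_mem hc hx (by rwa [hxy])
  exact ⟨_, h⟩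

/-- In a common apartment two lines are an even number `2k` of steps apart, and the reflection in
the element halfway between exchanges them. -/
theorem exists_act_eq_line (l l' : L) :
    ∃ g : Γ.Collineation, g.act (Sum.inr l) = Sum.inr l' := by
  obtain ⟨c, hc, ⟨i, hi⟩, ⟨j, hj⟩⟩ := hΓ.hexagon.exists_apartment (Sum.inr l) (Sum.inr l')
  have key : ∀ n : ℕ, (c (i + n)).isLeft = true ↔ ¬ Even n := by
    intro n
    induction n with
    | zero => simp [hi]
    | succ n ih =>
      have := isLeft_ne_of_adj (hc.adj_natCast i n)
      rw [Nat.even_add_one, ← ih]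
      generalize (c (i + n)).isLeft = a at *
      generalize (c (i + (n + 1 : ℕ))).isLeft = b at *
      cases a <;> cases b <;> simp_all
  have e : i + ((j - i).val : ZMod 12) = j := by simp
  have hev : Even (j - i).val := by
    by_contra hodd
    have := (key _).2 hodd
    rw [e, hj] at this
    simp at this
  obtain ⟨k, hk⟩ := hev
  obtain ⟨g, hg⟩ := hΓ.exists_reflection hc (i + k)
  refine ⟨g, ?_⟩
  rw [← hi, hg, ← hj]
  congr 1
  rw [hk] at e
  push_cast at e
  linear_combination e

end IsMoufangHexagon

end PointLineGeometry

/-! ### Collineations fixing line balls and the root group `U₃` -/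

namespace PointLineGeometry

section Labelling

variable {G : Type*} [Group G] {A : Type*} [AddCommGroup A] {U : Subgroup G} {x : A → G}

theorem mul_comm_of_comm_eq_one {g h : G} (e : comm g h = 1) : g * h = h * g := by
  rw [comm, mul_assoc, mul_assoc, inv_mul_eq_one] at e
  exact (eq_inv_mul_iff_mul_eq.1 e).symm

namespace IsLabelling

theorem mem (h : IsLabelling U x) (a : A) : x a ∈ U := by
  have := Set.mem_range_self (f := x) a
  rwa [h.2.1] at this

theorem exists_eq (h : IsLabelling U x) {g : G} (hg : g ∈ U) : ∃ a, x a = g := by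
  have : g ∈ Set.range x := by rw [h.2.1]; exact hg
  exact this

theorem zero (h : IsLabelling U x) : x 0 = 1 := by
  have := h.2.2 0 0
  rwa [add_zero, left_eq_mul] at this

theorem neg (h : IsLabelling U x) (a : A) : x (-a) = (x a)⁻¹ := by
  rw [eq_inv_iff_mul_eq_one, ← h.2.2, neg_add_cancel, h.zero]

theorem eq_one_iff (h : IsLabelling U x) {a : A} : x a = 1 ↔ a = 0 := by
  rw [← h.zero, h.1.eq_iff]

end IsLabelling

end Labelling

variable {P : Type w} {L : Type z} {Γ : PointLineGeometry P L}

open Collineation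

theorem Collineation.FixesStar.act_of_commute {θ u : Γ.Collineation} {q : P ⊕ L}
    (h : θ.FixesStar q) (hu : u * θ = θ * u) : θ.FixesStar (u.act q) := by
  have key : ∀ z, θ.act z = z → θ.act (u.act z) = u.act z := fun z hz => by
    rw [← act_mul, ← hu, act_mul, hz]
  refine ⟨key q h.1, fun y hy => ?_⟩
  have := u⁻¹.adj_act hy
  rw [act_inv_act] at this
  have := key _ (h.2 _ this)
  rwa [act_act_inv] at this

/-- The ball of radius 3 is covered by the stars of the elements `q` two steps from `l`; `q = l` is
allowed. -/
theorem IsGeneralizedHexagon.fixesBall_of_fixesStar (hΓ : Γ.IsGeneralizedHexagon)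
    (ht : Γ.IsThick) {θ : Γ.Collineation} {l : P ⊕ L}
    (h : ∀ p q, Γ.incGraph.Adj l p → Γ.incGraph.Adj p q → θ.FixesStar q) : θ.FixesBall l := by
  obtain ⟨p, hp, -⟩ := ht.exists_adj_ne l l l
  have hl := h p l hp hp.symm
  intro y hy
  by_cases h0 : l = y
  · rw [← h0]
    exact hl.1
  obtain ⟨y₁, a₁, d₁⟩ := hΓ.exists_closer h0
  by_cases h1 : l = y₁
  · exact hl.2 y (h1 ▸ a₁.symm)
  obtain ⟨y₂, a₂, d₂⟩ := hΓ.exists_closer h1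
  by_cases h2 : l = y₂
  · exact (h y₁ y (h2 ▸ a₂.symm) a₁.symm).1
  obtain ⟨y₃, a₃, d₃⟩ := hΓ.exists_closer h2
  have h3 : l = y₃ := hΓ.connected.dist_eq_zero_iff.1 (by omega)
  exact (h y₂ y₁ (h3 ▸ a₃.symm) a₂.symm).2 y a₁.symm

namespace AssociatedTo

variable {F : Type u} {J : Type v} [Field F] [AddCommGroup J] [Module F J]
  {S : HexagonalSystem F J} (A : Γ.AssociatedTo S)

include A in
theorem exists_line : ∃ l, A.apt 6 = Sum.inr l := by
  have h := A.isApartment.2 6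
  rw [show (6 : ZMod 12) + 1 = 7 by decide] at h
  obtain ⟨p, hp⟩ := A.apt_point
  rcases h with ⟨p', l, h1, h2, -⟩ | ⟨p', l, h1, h2, -⟩
  · rw [hp] at h2
    cases h2
  · exact ⟨l, h1⟩

/-- If the trace form vanishes, then the elements of `U₃` are central in `⟨U₁, …, U₆⟩` and fix
the ball of radius `3` centred at the line `6`. -/
theorem fixesBall_x₃ (hΓ : Γ.IsMoufangHexagon) (hT : ∀ a b, S.T a b = 0) (a : J) :
    (A.x₃ a).FixesBall (A.apt 6) := by
  have hc := A.isApartment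
  have star : ∀ k : ℕ, 1 ≤ k → k ≤ 5 → (A.x₃ a).FixesStar (A.apt (3 + k)) :=
    hc.rootGroup_fixesStar (A.label₃.mem a)
  have h4 : (A.x₃ a).FixesStar (A.apt 4) := star 1 (by norm_num) (by norm_num)
  have h6 : (A.x₃ a).FixesStar (A.apt 6) := star 3 (by norm_num) (by norm_num)
  have h8 : (A.x₃ a).FixesStar (A.apt 8) := star 5 (by norm_num) (by norm_num)
  have five : ∀ q, Γ.incGraph.Adj (A.apt 5) q → (A.x₃ a).FixesStar q := by
    intro q hq
    by_cases hq6 : q = A.apt 6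
    · rwa [hq6]
    · obtain ⟨u, hu, rfl⟩ := hΓ.moufang A.apt hc 5 (A.apt 4) q (hc.2 4).symm
        (fun h => absurd (hc.1 h) (by decide)) hq hq6
      obtain ⟨b, rfl⟩ := A.label₅.exists_eq hu
      refine h4.act_of_commute (mul_comm_of_comm_eq_one ?_).symm
      rw [A.comm₃₅, hT, A.label₄.zero]
  refine hΓ.hexagon.fixesBall_of_fixesStar hΓ.thick fun p q hp hq => ?_
  by_cases hp7 : p = A.apt 7
  · by_cases hq6 : q = A.apt 6
    · rwa [hq6]
    · rw [hp7] at hq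
      obtain ⟨u, hu, rfl⟩ := hΓ.moufang_end hc 1 (y := A.apt 8) (y' := q) (hc.2 7)
        (fun h => absurd (hc.1 h) (by decide)) hq hq6
      obtain ⟨b, rfl⟩ := A.label₁.exists_eq hu
      refine h8.act_of_commute (mul_comm_of_comm_eq_one ?_)
      rw [A.comm₁₃, hT, A.label₂.zero]
  · obtain ⟨u, hu, rfl⟩ := hΓ.moufang A.apt hc 6 (A.apt 5) p (hc.2 5).symm
      (fun h => absurd (hc.1 h) (by decide)) hp hp7
    obtain ⟨t, rfl⟩ := A.label₆.exists_eq hu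
    have h5 := (A.x₆ t)⁻¹.adj_act hq
    rw [act_inv_act] at h5
    have := (five _ h5).act_of_commute (mul_comm_of_comm_eq_one (A.comm₃₆ a t)).symm
    rwa [act_act_inv] at this

theorem fixesExactlyLineBall_x₃ (hΓ : Γ.IsMoufangHexagon) (hT : ∀ a b, S.T a b = 0) {a : J}
    (ha : a ≠ 0) : Γ.FixesExactlyLineBall (A.x₃ a) := by
  obtain ⟨l, hl⟩ := A.exists_line
  refine ⟨l, fun x => ?_⟩
  rw [hΓ.hexagon.edist_le_three_iff, ← hl]
  exact hΓ.hexagon.fixed_iff_of_fixesBall hΓ.thick (A.fixesBall_x₃ hΓ hT a)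
    (mt A.label₃.eq_one_iff.1 ha) x

theorem exists_conj_eq_x₃ (hΓ : Γ.IsMoufangHexagon) {θ : Γ.Collineation}
    (hθ : Γ.FixesExactlyLineBall θ) :
    ∃ g a, a ≠ 0 ∧ g * θ * g⁻¹ = A.x₃ a ∧ (A.x₃ a).FixesBall (A.apt 6) := by
  obtain ⟨l, hl⟩ := hθ
  obtain ⟨l', hl'⟩ := A.exists_line
  obtain ⟨g, hg⟩ := hΓ.exists_act_eq_line l l'
  have hball : θ.FixesBall (Sum.inr l) := fun y hy =>
    (hl y).2 (hΓ.hexagon.edist_le_three_iff.2 hy)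
  have hconj := hball.conj g
  rw [hg, ← hl'] at hconj
  obtain ⟨a, ha⟩ := A.label₃.exists_eq
    (hΓ.hexagon.mem_rootGroup_of_fixesBall A.isApartment (i := 3) hconj)
  refine ⟨g, a, ?_, ha.symm, by rwa [ha]⟩
  -- If `a = 0` then `θ = 1`, which would also fix an element opposite `l`.
  rintro rfl
  rw [A.label₃.zero, eq_comm, conj_eq_one_iff] at ha
  obtain ⟨c, hc, ⟨i, hi⟩, -⟩ := hΓ.hexagon.exists_apartment (Sum.inr l) (Sum.inr l)
  have hd := hΓ.hexagon.dist_apartment hc i 6 le_rfl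
  have := (hl (c (i + (6 : ℕ)))).1 (by rw [ha, act_one])
  rw [hΓ.hexagon.edist_le_three_iff, ← hi, hd] at this
  omega

/-- The commutator with `x₁ b` is a product of two elements fixing the ball about 6, and it equals
`x₂ (T b a)`. The element `9 = 2 + 7` lies in that ball, so freeness of `U₂` applies. -/
theorem T_eq_zero_of_fixesBall (hΓ : Γ.IsMoufangHexagon) {a : J}
    (ha : (A.x₃ a).FixesBall (A.apt 6)) (b : J) : S.T a b = 0 := by
  have h6 : (A.x₁ b).act (A.apt 6) = A.apt 6 :=
    A.isApartment.rootGroup_fixes (A.label₁.mem b) 5 (by norm_num)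
  have hball : (comm (A.x₁ b) (A.x₃ a)).FixesBall (A.apt 6) :=
    (ha.inv.conj_of_fixed h6).mul ha
  rw [A.comm₁₃] at hball
  have h9 : Γ.incGraph.dist (A.apt 6) (A.apt 9) = 3 :=
    hΓ.hexagon.dist_apartment A.isApartment 6 3 (by norm_num)
  rw [S.T_symm, ← A.label₂.eq_one_iff]
  exact hΓ.hexagon.rootGroup_eq_one hΓ.thick A.isApartment (A.label₂.mem _) (hball _ h9.le)

section TraceZero

variable (hΓ : Γ.IsMoufangHexagon) (hT : ∀ a b, S.T a b = 0)
include hΓ hT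

/-- The reflection in `k` turns the root (3, …, 9) around its image starting at `2k - 9`, so every
odd-indexed root group inherits the property of `U₃`. -/
theorem fixesBall_of_mem_rootGroup (k : ZMod 12) {θ : Γ.Collineation}
    (hθ : θ ∈ Γ.rootGroup A.apt (2 * k - 9)) : θ.FixesBall (A.apt (2 * k - 6)) := by
  obtain ⟨g, hg⟩ := hΓ.exists_reflection A.isApartment k
  obtain ⟨a, ha⟩ := A.label₃.exists_eq (conj_mem_rootGroup hg (by ring) hθ)
  have := (A.fixesBall_x₃ hΓ hT a).conj g
  rw [ha, hg] at this
  convert this using 1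
  group

/-- The commutator fixes the balls about 8 and about 10. The element 0 is in the second and at
distance 4 from 8, which only the identity allows. -/
theorem commute_U₅_U₇ {h y : Γ.Collineation} (hh : h ∈ Γ.rootGroup A.apt 5)
    (hy : y ∈ Γ.rootGroup A.apt 7) : h * y = y * h := by
  have b8 : h.FixesBall (A.apt 8) := A.fixesBall_of_mem_rootGroup hΓ hT 7 hh
  have b10 : y.FixesBall (A.apt 10) := A.fixesBall_of_mem_rootGroup hΓ hT 8 hy
  have hc := A.isApartment
  have h10 : h.act (A.apt 10) = A.apt 10 := hc.rootGroup_fixes hh 5 (by norm_num)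
  have y8 : y.act (A.apt 8) = A.apt 8 := hc.rootGroup_fixes hy 1 (by norm_num)
  have c8 : (comm h y).FixesBall (A.apt 8) := by
    have := b8.inv.mul (b8.conj_of_fixed y8)
    simpa only [comm, mul_assoc] using this
  have c10 : (comm h y).FixesBall (A.apt 10) := (b10.inv.conj_of_fixed h10).mul b10
  have d8 : Γ.incGraph.dist (A.apt 8) (A.apt 0) = 4 :=
    hΓ.hexagon.dist_apartment hc 8 4 (by norm_num)
  have d10 : Γ.incGraph.dist (A.apt 10) (A.apt 0) = 2 :=
    hΓ.hexagon.dist_apartment hc 10 2 (by norm_num)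
  exact mul_comm_of_comm_eq_one
    (hΓ.hexagon.eq_one_of_fixesBall hΓ.thick c8 d8 (c10 _ (by omega)))

/-- The reflection given by `x₁ a` carries `x₅ b` to `x₃ (-(a × b))`. -/
theorem isConj_x₅_x₃ {a : J} (ha : a ≠ 0) (b : J) :
    IsConj (A.x₅ b) (A.x₃ (-S.cross a b)) := by
  have hc := A.isApartment
  have hx := A.label₁.mem a
  obtain ⟨y, hy, y', hy', hm⟩ := hΓ.exists_reflection_of_mem hc hx (fun h =>
    ha (A.label₁.eq_one_iff.1 (hΓ.hexagon.rootGroup_eq_one hΓ.thick hc hx h)))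
  replace hy : y ∈ Γ.rootGroup A.apt 7 := hy
  replace hy' : y' ∈ Γ.rootGroup A.apt 7 := hy'
  have hb := A.label₅.mem b
  set d := -S.cross a b with hd
  have hdm := A.label₃.mem d
  have hmem := conj_mem_rootGroup (k := 3) hm (by decide) hb
  have hyb : y⁻¹ * A.x₅ b * y = A.x₅ b := by
    rw [mul_assoc, A.commute_U₅_U₇ hΓ hT hb hy, inv_mul_cancel_left]
  -- With `T = 0` only the `x₃` factor of the relation for `[x₁ a, x₅ b]` survives.
  have hxb : (A.x₁ a)⁻¹ * A.x₅ b * A.x₁ a = A.x₅ b * A.x₃ d := by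
    have := A.comm₁₅ a b
    rw [hT, hT, neg_zero, A.label₂.zero, A.label₄.zero, one_mul, mul_one] at this
    rw [hd, A.label₃.neg, ← this, comm]
    group
  have hcalc : (y * A.x₁ a * y')⁻¹ * A.x₅ b * (y * A.x₁ a * y') =
      y'⁻¹ * (A.x₅ b * (A.x₃ d * y')) := by
    calc _ = y'⁻¹ * ((A.x₁ a)⁻¹ * (y⁻¹ * A.x₅ b * y) * A.x₁ a) * y' := by group
      _ = _ := by rw [hyb, hxb]; group
  have y10 : y'.act (A.apt 10) = A.apt 10 := hc.rootGroup_fixes hy' 3 (by norm_num)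
  have adj9 : Γ.incGraph.Adj (A.apt 9) ((A.x₃ d).act (A.apt 10)) := by
    have h9 : (A.x₃ d).act (A.apt 9) = A.apt 9 := hc.rootGroup_fixes hdm 6 le_rfl
    have := (A.x₃ d).adj_act (hc.2 9)
    rwa [h9] at this
  -- The conjugate lies in `U₃`, so by freeness its effect on `10 = 3 + 7` identifies it. It acts
  -- there as `x₃ d`, because `y'` fixes 10 and both `y'` and `x₅ b` fix every element incident with
  -- 9.
  have hact : (y'⁻¹ * (A.x₅ b * (A.x₃ d * y'))).act (A.apt 10) = (A.x₃ d).act (A.apt 10) := by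
    rw [act_mul, act_mul, act_mul, y10, hb 4 (by norm_num) (by norm_num) _ adj9]
    exact act_inv_fixed (hy' 2 (by norm_num) (by norm_num) _ adj9)
  rw [← hcalc] at hact
  have hone := hΓ.hexagon.rootGroup_eq_one hΓ.thick hc (mul_mem (inv_mem hdm) hmem) (by
    change _ = A.apt 10
    rw [act_mul]
    exact (congrArg _ hact).trans (act_inv_act _ _))
  rw [inv_mul_eq_one] at hone
  rw [isConj_iff]
  exact ⟨(y * A.x₁ a * y')⁻¹, by rw [inv_inv, hone]⟩

theorem isConj_x₃_one {a : J} (ha : a ≠ 0) : IsConj (A.x₃ a) (A.x₃ S.one) := by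
  have key : ∀ a : J, -S.cross a S.one = a := by
    intro a
    have := S.eq_T_sub_cross a
    rw [hT, zero_smul, zero_sub, S.cross_symm] at this
    exact this.symm
  have h1 := A.isConj_x₅_x₃ hΓ hT ha S.one
  have h2 := A.isConj_x₅_x₃ hΓ hT S.one_ne_zero S.one
  rw [key] at h1 h2
  exact h1.symm.trans h2

end TraceZero

end AssociatedTo

end PointLineGeometry

/-! ### Hexagonal systems with vanishing trace form -/

namespace HexagonalSystem

variable {F : Type u} {J : Type v} [Field F] [AddCommGroup J] [Module F J]
  (S : HexagonalSystem F J)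

/-- Moving factors across `T` shows that `T(a^# × (a × b), c)` has the form `T(a, ·)`, hence is
zero; the adjoint identity evaluates it as `N(a) T(b, c)`, with `N(a) ≠ 0`. -/
theorem T_eq_zero_of_radical {a : J} (ha : a ≠ 0) (h : ∀ b, S.T a b = 0) (b c : J) :
    S.T b c = 0 := by
  have h1 : S.T (S.cross (S.sharp a) (S.cross a b)) c = 0 := by
    rw [S.cross_symm, S.T_cross, S.T_cross, h]
  rw [S.sharp_cross_cross, map_add, LinearMap.add_apply, map_smul, map_smul,
    LinearMap.smul_apply, LinearMap.smul_apply, h, smul_zero, add_zero, smul_eq_mul,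
    mul_eq_zero, S.N_eq_zero_iff] at h1
  exact h1.resolve_left ha

theorem N_zero : S.N 0 = 0 := (S.N_eq_zero_iff 0).2 rfl

theorem N_one : S.N S.one = 1 := by
  have := S.sharp_sharp S.one
  rw [S.sharp_one, S.sharp_one] at this
  have h : (S.N S.one - 1) • S.one = 0 := by rw [sub_smul, ← this, one_smul, sub_self]
  exact sub_eq_zero.1 ((smul_eq_zero.1 h).resolve_right S.one_ne_zero)

theorem sharp_neg (a : J) : S.sharp (-a) = S.sharp a := by
  have := S.sharp_smul (-1) a
  rwa [neg_one_smul, neg_one_sq, one_smul] at this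

variable (hT : ∀ a b, S.T a b = 0)
include hT

theorem three_eq_zero : (3 : F) = 0 := by
  have := S.T_sharp S.one
  rwa [hT, S.N_one, mul_one, eq_comm] at this

theorem charP_three : CharP F 3 := by
  obtain ⟨p, hp⟩ := CharP.exists F
  have h : p ∣ 3 := (CharP.cast_eq_zero_iff F p 3).1 (by exact_mod_cast S.three_eq_zero hT)
  rcases (Nat.dvd_prime Nat.prime_three).1 h with rfl | rfl
  · exact absurd rfl (CharP.char_ne_one F 1)
  · exact hp

theorem N_add_of_T_eq_zero (a b : J) : S.N (a + b) = S.N a + S.N b := by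
  rw [S.N_add, hT, hT, add_zero, add_zero]

theorem add_add_self_eq_zero (a : J) : a + a + a = 0 := by
  have h : (3 : F) • a = a + a + a := by
    rw [show (3 : F) = 1 + 1 + 1 by norm_num, add_smul, add_smul, one_smul]
  rw [← h, S.three_eq_zero hT, zero_smul]

theorem neg_cross_one (a : J) : -S.cross S.one a = a := by
  have := S.eq_T_sub_cross a
  rw [hT, zero_smul, zero_sub] at this
  exact this.symm

theorem neg_cross_self (a : J) : -S.cross a a = S.sharp a := by
  have h1 := S.sharp_add a a
  have h2 := S.sharp_smul (2 : F) a
  have h3 : (2 : F) ^ 2 = 1 := by linear_combination S.three_eq_zero hT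
  rw [two_smul, h3, one_smul, h1] at h2
  rw [neg_eq_iff_add_eq_zero]
  have h4 : S.sharp a + (S.cross a a + S.sharp a) = S.sharp a := by rw [← add_assoc, h2]
  exact left_eq_add.1 h4.symm

theorem cross_ne_zero {a b : J} (ha : a ≠ 0) (hb : b ≠ 0) : S.cross a b ≠ 0 := by
  intro h
  have := S.sharp_cross_cross a b
  rw [h, map_zero, hT, zero_smul, add_zero, eq_comm, smul_eq_zero, S.N_eq_zero_iff] at this
  exact this.elim ha hb

theorem sharp_neg_cross (a b : J) :
    S.sharp (-S.cross a b) = -S.cross (S.sharp a) (S.sharp b) := by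
  have := S.sharp_cross_sharp a b
  rw [hT, hT, zero_smul, zero_smul, add_zero] at this
  rw [S.sharp_neg]
  exact (neg_eq_of_add_eq_zero_right this).symm

/-- For `T = 0` the adjoint is multiplicative up to sign. Applying it twice and using `a^## = N(a)a`
compares two scalars on the nonzero vector `a × b`. -/
theorem N_neg_cross (a b : J) : S.N (-S.cross a b) = S.N a * S.N b := by
  by_cases ha : a = 0
  · simp [ha, S.N_zero]
  by_cases hb : b = 0
  · simp [hb, S.N_zero]
  have h := S.sharp_sharp (-S.cross a b)
  rw [S.sharp_neg_cross hT, S.sharp_neg_cross hT, S.sharp_sharp, S.sharp_sharp, map_smul,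
    map_smul, LinearMap.smul_apply, smul_smul, ← smul_neg] at h
  have h2 := smul_left_injective F (neg_ne_zero.2 (S.cross_ne_zero hT ha hb)) h
  rw [← h2, mul_comm]

/-- The norm is additive, multiplicative and anisotropic, so the product is associative. -/
theorem neg_cross_assoc (a b c : J) :
    -S.cross (-S.cross a b) c = -S.cross a (-S.cross b c) := by
  rw [← sub_eq_zero, ← S.N_eq_zero_iff]
  -- Both bracketings have norm `N(a)N(b)N(c)`, so by additivity their difference has norm zero.
  have h := S.N_add_of_T_eq_zero hT
    (-S.cross (-S.cross a b) c - -S.cross a (-S.cross b c)) (-S.cross a (-S.cross b c))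
  rw [sub_add_cancel] at h
  simp only [S.N_neg_cross hT] at h
  linear_combination -h

theorem neg_cross_sharp (a : J) : -S.cross a (S.sharp a) = S.N a • S.one := by
  have h := S.sharp_cross_cross a S.one
  rw [hT, zero_smul, add_zero, S.cross_symm a, ← neg_neg (S.cross S.one a),
    S.neg_cross_one hT, map_neg, S.cross_symm] at h
  exact h

/-- The product `ab = -(a × b)` makes `J` a commutative ring. -/
abbrev commRingOfTraceZero : CommRing J :=
  { ‹AddCommGroup J› with
    mul := fun a b => -S.cross a b
    one := S.one
    left_distrib := fun a b c => by
      change -S.cross a (b + c) = -S.cross a b + -S.cross a c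
      rw [map_add, neg_add]
    right_distrib := fun a b c => by
      change -S.cross (a + b) c = -S.cross a c + -S.cross b c
      rw [map_add, LinearMap.add_apply, neg_add]
    zero_mul := fun a => by
      change -S.cross 0 a = 0
      simp
    mul_zero := fun a => by
      change -S.cross a 0 = 0
      simp
    mul_assoc := S.neg_cross_assoc hT
    one_mul := S.neg_cross_one hT
    mul_one := fun a => by
      change -S.cross a S.one = a
      rw [S.cross_symm, S.neg_cross_one hT]
    mul_comm := fun a b => by
      change -S.cross a b = -S.cross b a
      rw [S.cross_symm] }

/-- The product `ab = -(a × b)` makes `J` a field, with inverse `N(a)⁻¹a^#`. -/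
abbrev fieldOfTraceZero : Field J :=
  { S.commRingOfTraceZero hT with
    inv := fun a => (S.N a)⁻¹ • S.sharp a
    exists_pair_ne := ⟨S.one, 0, S.one_ne_zero⟩
    mul_inv_cancel := fun a ha => by
      change -S.cross a ((S.N a)⁻¹ • S.sharp a) = S.one
      rw [map_smul, ← smul_neg, S.neg_cross_sharp hT, smul_smul,
        inv_mul_cancel₀ (mt (S.N_eq_zero_iff a).1 ha), one_smul]
    inv_zero := by
      change (S.N 0)⁻¹ • S.sharp 0 = 0
      rw [S.N_zero, inv_zero, zero_smul]
    nnqsmul := _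
    nnqsmul_def := fun _ _ => rfl
    qsmul := _
    qsmul_def := fun _ _ => rfl }

/-- `J` as a field extension of `F`. -/
abbrev algebraOfTraceZero : @Algebra F J _ (S.fieldOfTraceZero hT).toSemiring :=
  letI := S.fieldOfTraceZero hT
  Algebra.ofModule
    (fun r a b => by
      change -S.cross (r • a) b = r • -S.cross a b
      rw [map_smul, LinearMap.smul_apply, smul_neg])
    (fun r a b => by
      change -S.cross a (r • b) = r • -S.cross a b
      rw [map_smul, smul_neg])

theorem algebraMap_N (a : J) :
    letI := S.fieldOfTraceZero hT
    letI := S.algebraOfTraceZero hT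
    algebraMap F J (S.N a) = a ^ 3 := by
  let _ := S.fieldOfTraceZero hT
  let _ := S.algebraOfTraceZero hT
  have h : a ^ 3 = a * (a * a) := by ring
  rw [h, Algebra.algebraMap_eq_smul_one]
  change S.N a • S.one = -S.cross a (-S.cross a a)
  rw [S.neg_cross_self hT, S.neg_cross_sharp hT]

end HexagonalSystem

/-! ### Identification with the mixed class and conclusion -/

namespace PointLineGeometry

variable {P : Type w} {L : Type z} {Γ : PointLineGeometry P L}
  {F : Type u} {J : Type v} [Field F] [AddCommGroup J] [Module F J]
  {S : HexagonalSystem F J}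

/-- Association only depends on the four operations of a hexagonal system. -/
def AssociatedTo.congr {S' : HexagonalSystem F J} (A : Γ.AssociatedTo S)
    (hT : S.T = S'.T) (hs : S.sharp = S'.sharp) (hN : S.N = S'.N) (hc : S.cross = S'.cross) :
    Γ.AssociatedTo S' :=
  { A with
    comm₁₃ := fun a b => by rw [← hT]; exact A.comm₁₃ a b
    comm₁₅ := fun a b => by rw [← hT, ← hs, ← hc]; exact A.comm₁₅ a b
    comm₁₆ := fun a t => by rw [← hN, ← hs]; exact A.comm₁₆ a t
    comm₃₅ := fun a b => by rw [← hT]; exact A.comm₃₅ a b }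

theorem AssociatedTo.inClassH4 (A : Γ.AssociatedTo S) (hT : ∀ a b, S.T a b = 0) :
    InClassH4.{u, v} Γ := by
  let iE := S.fieldOfTraceZero hT
  let iA := S.algebraOfTraceZero hT
  have := S.charP_three hT
  have h : ∀ a : J, ∃ t : F, algebraMap F J t = a ^ 3 := fun a => ⟨S.N a, S.algebraMap_N hT a⟩
  refine ⟨F, J, inferInstance, iE, iA, inferInstance, h, ⟨A.congr ?_ ?_ ?_ ?_⟩⟩
  · ext a b
    exact hT a b
  · ext a
    change S.sharp a = a ^ 2
    rw [pow_two]
    exact (S.neg_cross_self hT a).symm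
  · ext a
    -- The norm of `mixedSystem` is a chosen preimage of `a³`, so it can only be compared after
    -- embedding in `J`.
    apply (algebraMap F J).injective
    rw [S.algebraMap_N hT]
    exact (h a).choose_spec.symm
  · ext a b
    change S.cross a b = (2 : F) • (-S.cross a b)
    -- In characteristic 3 multiplication by `-2` is the identity.
    rw [two_smul, eq_comm, ← sub_eq_zero, sub_eq_add_neg, ← neg_add, ← neg_add,
      S.add_add_self_eq_zero hT, neg_zero]

theorem InClassH4.exists_fixesExactlyLineBall (hΓ : Γ.IsMoufangHexagon)
    (h : InClassH4.{u, v} Γ) : ∃ θ : Γ.Collineation, Γ.FixesExactlyLineBall θ := by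
  obtain ⟨F, E, _, _, _, _, h, ⟨A⟩⟩ := h
  exact ⟨_, A.fixesExactlyLineBall_x₃ hΓ (fun _ _ => rfl) (mixedSystem F E h).one_ne_zero⟩

theorem AssociatedTo.T_eq_zero (hΓ : Γ.IsMoufangHexagon) (A : Γ.AssociatedTo S)
    {θ : Γ.Collineation} (hθ : Γ.FixesExactlyLineBall θ) (a b : J) : S.T a b = 0 := by
  obtain ⟨g, c, hc, -, hball⟩ := A.exists_conj_eq_x₃ hΓ hθ
  exact S.T_eq_zero_of_radical hc (A.T_eq_zero_of_fixesBall hΓ hball) a b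

end PointLineGeometry

theorem mainTheorem11 {P : Type w} {L : Type z} {F : Type u} {J : Type v}
    [Field F] [AddCommGroup J] [Module F J]
    (Γ : PointLineGeometry P L) (hΓ : Γ.IsMoufangHexagon)
    (S : HexagonalSystem F J) (A : Γ.AssociatedTo S) :
    ((∃ θ : Γ.Collineation, Γ.FixesExactlyLineBall θ) ↔
      PointLineGeometry.InClassH4.{u, v} Γ) ∧
    (PointLineGeometry.InClassH4.{u, v} Γ →
      ∀ θ : Γ.Collineation, Γ.FixesExactlyLineBall θ → IsConj θ (A.x₃ S.one)) := by
  refine ⟨⟨fun ⟨θ, hθ⟩ => A.inClassH4 (A.T_eq_zero hΓ hθ),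
    fun h => h.exists_fixesExactlyLineBall hΓ⟩, fun _ θ hθ => ?_⟩
  obtain ⟨g, a, ha, hg, -⟩ := A.exists_conj_eq_x₃ hΓ hθ
  exact (isConj_iff.2 ⟨g, hg⟩).trans (A.isConj_x₃_one hΓ (A.T_eq_zero hΓ hθ) ha)
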